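/- Let $L^1(\mathbb R_+)$ be the complex Banach algebra of integrable functions on $\mathbb R_+=[0,\infty)$ with the convolution product $(f*g)(t)=\int_0^t f(t-s)g(s)\,ds$. By an algebra homomorphism on $L^1(\mathbb R_+)$ we mean a bounded linear operator into a complex Banach algebra (not necessarily unital) which maps convolution to multiplication. Call bounded operators $T:L^1(\mathbb R_+)\to X$ and $S:L^1(\mathbb R_+)\to Y$ equivalent if there are constants $c_1,c_2>0$ such that $\|Tg\|_X\le c_1\|Sg\|_Y\le c_2\|Tg\|_X$ for every $g\in L^1(\mathbb R_+)$. Let $\mathcal L(X)$ denote the algebra of bounded linear operators on a Banach space $X$. Let $\mathcal A$ be a complex Banach algebra and let $T:L^1(\mathbb R_+)\to\mathcal A$ be an algebra homomorphism. Then there exist a complex Banach space $X_0$, an algebra homomorphism $S:L^1(\mathbb R_+)\to\mathcal L(X_0)$ equivalent to $T$, and a uniformly bounded $C_0$-semigroup $(S(t))_{t\ge 0}\subset\mathcal L(X_0)$ such that for every $g\in L^1(\mathbb R_+)$ and every $x\in X_0$ $$ (Sg)x=\int_0^\infty S(t)x\,g(t)\,dt . $$ If $\mathcal A$ is a closed subalgebra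 of $\mathcal L(X)$ for some complex Banach space $X$ (or, more generally, is identified with such a closed subalgebra by an algebra isomorphism that is a homeomorphism), then $X_0$ can be chosen to be a closed subspace of $X$ with the norm of $X$. -/

import Mathlib

universe u v

open MeasureTheory Set
open scoped NNReal

/-- The complex Banach space `L¹(ℝ₊)`, with `ℝ₊ = [0, ∞)` carrying Lebesgue measure. -/
abbrev L1Plus : Type := Lp ℂ 1 (volume.restrict (Ici (0 : ℝ)))

namespace L1Plus

/-- For `f, g ∈ L¹(ℝ₊)`, the function `t ↦ ∫₀ᵗ f (t - s) g s ds` is integrable on `ℝ₊`. -/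
theorem integrable_conv (f g : L1Plus) :
    Integrable (fun t : ℝ => ∫ s in (0 : ℝ)..t, f (t - s) * g s)
      (volume.restrict (Ici (0 : ℝ))) := by
  have hf : IntegrableOn f (Ioi (0 : ℝ)) := by
    have := L1.integrable_coeFn f
    exact IntegrableOn.mono_set this Ioi_subset_Ici_self
  have hg : IntegrableOn g (Ioi (0 : ℝ)) := by
    have := L1.integrable_coeFn g
    exact IntegrableOn.mono_set this Ioi_subset_Ici_self
  have h := integrable_posConvolution hg hf (ContinuousLinearMap.mul ℝ ℂ)
  have h' := h.integrableOn (s := Ioi (0 : ℝ))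
  refine (integrableOn_Ici_iff_integrableOn_Ioi (μ := volume)).mpr ?_
  refine h'.congr_fun (fun t ht => ?_) measurableSet_Ioi
  simp only [posConvolution, indicator_of_mem ht, ContinuousLinearMap.mul_apply']
  exact intervalIntegral.integral_congr fun s _ => mul_comm _ _

/-- The convolution product `(f * g)(t) = ∫₀ᵗ f (t - s) g s ds` on `L¹(ℝ₊)`. -/
noncomputable def conv (f g : L1Plus) : L1Plus :=
  (integrable_conv f g).toL1 (fun t : ℝ => ∫ s in (0 : ℝ)..t, f (t - s) * g s)

end L1Plus

/-- A bounded linear operator `T : L¹(ℝ₊) → A` is an algebra homomorphism if it maps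
convolution to multiplication. -/
def IsConvHom {A : Type*} [NonUnitalNormedRing A] [NormedSpace ℂ A]
    (T : L1Plus →L[ℂ] A) : Prop :=
  ∀ f g : L1Plus, T (L1Plus.conv f g) = T f * T g

/-- Equivalence of bounded operators on `L¹(ℝ₊)`:
`‖T g‖ ≤ c₁ ‖S g‖ ≤ c₂ ‖T g‖` for all `g`. The constants are taken positive: with `c₁ = 0`
every operator would count as equivalent to `0`. -/
def EquivalentOperators {X Y : Type*} [NormedAddCommGroup X] [NormedSpace ℂ X]
    [NormedAddCommGroup Y] [NormedSpace ℂ Y]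
    (T : L1Plus →L[ℂ] X) (S : L1Plus →L[ℂ] Y) : Prop :=
  ∃ c₁ c₂ : ℝ, 0 < c₁ ∧ 0 < c₂ ∧
    ∀ g : L1Plus, ‖T g‖ ≤ c₁ * ‖S g‖ ∧ c₁ * ‖S g‖ ≤ c₂ * ‖T g‖

/-- `(V t)_{t ≥ 0}` is a uniformly bounded `C₀`-semigroup of bounded operators on `X`. -/
structure IsBoundedC0Semigroup {X : Type*} [NormedAddCommGroup X] [NormedSpace ℂ X]
    (V : ℝ≥0 → X →L[ℂ] X) : Prop where
  map_zero : V 0 = ContinuousLinearMap.id ℂ X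
  map_add : ∀ s t : ℝ≥0, V (s + t) = (V s).comp (V t)
  continuous_orbit : ∀ x : X, Continuous fun t : ℝ≥0 => V t x
  bounded : ∃ M : ℝ, ∀ t : ℝ≥0, ‖V t‖ ≤ M

/-- `S` is strongly represented by `V`: for all `g ∈ L¹(ℝ₊)` and `x ∈ X`, the Bochner integral
`∫₀^∞ g t • V t x dt` exists and equals `(S g) x`. -/
def IsStronglyRepresentedBy {X : Type*} [NormedAddCommGroup X] [NormedSpace ℂ X]
    (S : L1Plus →L[ℂ] (X →L[ℂ] X)) (V : ℝ≥0 → X →L[ℂ] X) : Prop :=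
  ∀ (g : L1Plus) (x : X),
    IntegrableOn (fun t : ℝ => g t • V t.toNNReal x) (Ici 0) ∧
      S g x = ∫ t in Ici (0 : ℝ), g t • V t.toNNReal x

/-- `T` is equivalent to an algebra homomorphism `S : L¹(ℝ₊) → 𝓛(X₀)` which is strongly
represented by a uniformly bounded `C₀`-semigroup on `X₀`. -/
def HasEquivalentSemigroupHom {A : Type*} [NonUnitalNormedRing A] [NormedSpace ℂ A]
    (T : L1Plus →L[ℂ] A) (X₀ : Type*) [NormedAddCommGroup X₀] [NormedSpace ℂ X₀] : Prop :=
  ∃ (S : L1Plus →L[ℂ] (X₀ →L[ℂ] X₀)) (V : ℝ≥0 → X₀ →L[ℂ] X₀),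
    IsConvHom S ∧ EquivalentOperators T S ∧
      IsBoundedC0Semigroup V ∧ IsStronglyRepresentedBy S V

/-! `L1Plus` has no unit, but the bumps `bump t h` lie in its unit ball and approximate the Dirac
mass at `t`: `conv f (bump t h)` tends to `shift t f` (`tendsto_conv_bump`). Represent `T` on a
space (on `A` by left multiplication, or on `X` through `j`) and restrict to the closed span `X₀` of
the ranges. There the images of the bumps converge strongly to operators `V t` carrying `S f x` to
`S (shift t f) x` (`exists_shift_operator`). The semigroup laws and strong continuity descend from
translations, and the integral formula is `conv f g = ∫ g s • shift s f` (`conv_eq_integral`). The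
bumps at `t = 0` form a bounded approximate unit, so neither the representation nor the restriction
to `X₀` loses the norm, up to constants. -/

open Filter Topology

/-! ### Right translations on L¹(ℝ₊) -/

namespace L1Plus

theorem integrable_indicator_comp_sub (t : ℝ) (f : L1Plus) :
    Integrable (fun x : ℝ => (Ici (0 : ℝ)).indicator f (x - t)) :=
  ((integrable_indicator_iff measurableSet_Ici).2 (L1.integrable_coeFn f)).comp_sub_right t

/-- The right translate `x ↦ f (x - t)` of `f`, where `f` is extended by zero to `ℝ`. -/
noncomputable def shift (t : ℝ) (f : L1Plus) : L1Plus :=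
  (integrable_indicator_comp_sub t f).restrict.toL1
    (fun x : ℝ => (Ici (0 : ℝ)).indicator f (x - t))

theorem coeFn_shift (t : ℝ) (f : L1Plus) :
    shift t f =ᵐ[volume.restrict (Ici (0 : ℝ))]
      fun x : ℝ => (Ici (0 : ℝ)).indicator f (x - t) :=
  Integrable.coeFn_toL1 _

theorem shift_zero (f : L1Plus) : shift 0 f = f := by
  refine Lp.ext ?_
  filter_upwards [coeFn_shift 0 f, ae_restrict_mem measurableSet_Ici] with x hx hx0
  rw [hx, sub_zero, indicator_of_mem hx0]

/-- Only the inner shift needs a sign: for `t < 0` it would cut off mass at the origin. -/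
theorem shift_shift (s : ℝ) {t : ℝ} (ht : 0 ≤ t) (f : L1Plus) :
    shift s (shift t f) = shift (s + t) f := by
  refine Lp.ext ?_
  have h := coeFn_shift t f
  rw [EventuallyEq, ae_restrict_iff' measurableSet_Ici] at h
  have h' := (measurePreserving_sub_right volume s).quasiMeasurePreserving.ae h
  filter_upwards [coeFn_shift s (shift t f), coeFn_shift (s + t) f, ae_restrict_of_ae h']
    with x h1 h2 h3
  rw [h1, h2]
  by_cases hx : x - s ∈ Ici (0 : ℝ)
  · rw [indicator_of_mem hx, h3 hx, sub_sub]
  · rw [indicator_of_notMem hx, indicator_of_notMem]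
    simp only [mem_Ici, not_le] at hx ⊢
    linarith

theorem norm_shift_le (t : ℝ) (f : L1Plus) : ‖shift t f‖ ≤ ‖f‖ := by
  have h0 := integrable_indicator_comp_sub t f
  rw [L1.norm_eq_integral_norm, L1.norm_eq_integral_norm]
  calc ∫ x in Ici (0 : ℝ), ‖shift t f x‖
      = ∫ x in Ici (0 : ℝ), ‖(Ici (0 : ℝ)).indicator f (x - t)‖ :=
        integral_congr_ae ((coeFn_shift t f).fun_comp norm)
    _ ≤ ∫ x, ‖(Ici (0 : ℝ)).indicator f (x - t)‖ :=
        setIntegral_le_integral h0.norm (Eventually.of_forall fun _ => norm_nonneg _)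
    _ = ∫ x, ‖(Ici (0 : ℝ)).indicator f x‖ :=
        integral_sub_right_eq_self (fun x => ‖(Ici (0 : ℝ)).indicator f x‖) t
    _ = ∫ x in Ici (0 : ℝ), ‖f x‖ := by
        rw [← integral_indicator measurableSet_Ici]
        simp only [norm_indicator_eq_indicator_norm]

theorem continuous_shift (f : L1Plus) : Continuous fun t : ℝ => shift t f := by
  have hi : Integrable ((Ici (0 : ℝ)).indicator f) :=
    (integrable_indicator_iff measurableSet_Ici).2 (L1.integrable_coeFn f)
  -- Continuity is inherited from the translation action of ℝ on L¹(ℝ), followed by restriction to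
  -- the half-line.
  have key : ∀ t : ℝ, shift t f = LpToLpRestrictCLM ℝ ℂ ℂ volume 1 (Ici (0 : ℝ))
      (DomAddAct.mk (-t) +ᵥ hi.toL1 _) := by
    intro t
    refine Lp.ext ?_
    have h := (measurePreserving_add_left volume (-t)).quasiMeasurePreserving.ae hi.coeFn_toL1
    filter_upwards [coeFn_shift t f,
      LpToLpRestrictCLM_coeFn ℂ (Ici (0 : ℝ)) (DomAddAct.mk (-t) +ᵥ hi.toL1 _),
      ae_restrict_of_ae (DomAddAct.vadd_Lp_ae_eq (DomAddAct.mk (-t)) (hi.toL1 _)),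
      ae_restrict_of_ae h] with x h1 h2 h3 h4
    rw [h1, h2, h3]
    simp only [Equiv.symm_apply_apply, vadd_eq_add]
    rw [h4, neg_add_eq_sub]
  simp_rw [key]
  have : Fact ((1 : ENNReal) ≠ ⊤) := ⟨ENNReal.one_ne_top⟩
  refine (ContinuousLinearMap.continuous _).comp ?_
  exact (DomAddAct.continuous_mk.comp continuous_neg).vadd continuous_const

/-! ### Convolution as a Bochner integral of translates -/

theorem integrable_smul_shift (f g : L1Plus) :
    IntegrableOn (fun s : ℝ => g s • shift s f) (Ici 0) :=
  (L1.integrable_coeFn g).smul_bdd ‖f‖ (continuous_shift f).aestronglyMeasurable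
    (Eventually.of_forall fun s => norm_shift_le s f)

theorem conv_comm (f g : L1Plus) : conv f g = conv g f := by
  refine (Integrable.toL1_eq_toL1_iff _ _ _ _).2 (Eventually.of_forall fun t => ?_)
  have h := intervalIntegral.integral_comp_sub_left (a := 0) (b := t)
    (fun s => f s * g (t - s)) t
  simp only [sub_sub_cancel, sub_self, sub_zero] at h
  simp only [h, mul_comm]

theorem coeFn_conv (f g : L1Plus) :
    conv f g =ᵐ[volume.restrict (Ici (0 : ℝ))]
      fun x => ∫ s in Ici (0 : ℝ), g s * (Ici (0 : ℝ)).indicator f (x - s) := by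
  filter_upwards [(integrable_conv f g).coeFn_toL1, ae_restrict_mem measurableSet_Ici]
    with x hx hx0
  have hx0 : 0 ≤ x := hx0
  rw [conv, hx, intervalIntegral.integral_of_le hx0, ← integral_Icc_eq_integral_Ioc,
    ← integral_indicator measurableSet_Icc, ← integral_indicator measurableSet_Ici]
  refine integral_congr_ae (Eventually.of_forall fun s => ?_)
  by_cases h0 : 0 ≤ s <;> by_cases h1 : s ≤ x <;> simp [indicator, h0, h1, mul_comm]

/-- Integration over a set as a continuous functional on `L¹(ℝ₊)`. -/
noncomputable def setIntegralCLM (E : Set ℝ) : L1Plus →L[ℂ] ℂ :=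
  (L1.integralCLM' ℂ).comp (LpToLpRestrictCLM ℝ ℂ ℂ (volume.restrict (Ici (0 : ℝ))) 1 E)

theorem setIntegralCLM_apply (E : Set ℝ) (f : L1Plus) :
    setIntegralCLM E f = ∫ x in E, f x ∂volume.restrict (Ici (0 : ℝ)) := by
  rw [← integral_congr_ae (LpToLpRestrictCLM_coeFn ℂ E f)]
  exact (L1.integral_eq' (𝕜 := ℂ) _).symm.trans (L1.integral_eq_integral _)

/-- Integrating over an arbitrary set `E` is a bounded functional, so it passes inside the
vector-valued integral; the two sides then agree by Fubini. -/
theorem conv_eq_integral (f g : L1Plus) :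
    conv f g = ∫ s in Ici (0 : ℝ), g s • shift s f := by
  have hF : Integrable ((Ici (0 : ℝ)).indicator f) :=
    (integrable_indicator_iff measurableSet_Ici).2 (L1.integrable_coeFn f)
  refine Lp.ext (Integrable.ae_eq_of_forall_setIntegral_eq _ _ (L1.integrable_coeFn _)
    (L1.integrable_coeFn _) fun E hE _ => ?_)
  rw [← setIntegralCLM_apply E (∫ s in Ici (0 : ℝ), g s • shift s f),
    ← (setIntegralCLM E).integral_comp_comm (integrable_smul_shift f g),
    integral_congr_ae (ae_restrict_of_ae (coeFn_conv f g))]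
  have h := (L1.integrable_coeFn g).convolution_integrand (ContinuousLinearMap.mul ℝ ℂ) hF
  have h' := h.restrict (s := (E ∩ Ici (0 : ℝ)) ×ˢ univ)
  rw [← Measure.prod_restrict, Measure.restrict_univ, ← Measure.restrict_restrict hE] at h'
  rw [integral_integral_swap h']
  refine integral_congr_ae (Eventually.of_forall fun s => ?_)
  simp only [map_smul, smul_eq_mul, setIntegralCLM_apply]
  rw [integral_congr_ae (ae_restrict_of_ae (coeFn_shift s f))]
  exact integral_const_mul _ _

/-- The normalised indicator function of `(t, t + h]`, an approximation of the Dirac mass at `t`. -/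
noncomputable def bump (t h : ℝ) : L1Plus :=
  indicatorConstLp 1 (measurableSet_Ioc (a := t) (b := t + h))
    ((Measure.restrict_apply_le _ _).trans_lt measure_Ioc_lt_top).ne (h⁻¹ : ℂ)

theorem norm_bump_le (t h : ℝ) : ‖bump t h‖ ≤ 1 := by
  refine norm_indicatorConstLp_le.trans ?_
  simp only [ENNReal.toReal_one, div_one, Real.rpow_one, norm_inv, Complex.norm_real]
  have : (volume.restrict (Ici (0 : ℝ))).real (Ioc t (t + h)) ≤ |h| := by
    refine (ENNReal.toReal_mono measure_Ioc_lt_top.ne (Measure.restrict_apply_le _ _)).trans ?_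
    rw [Real.volume_Ioc, add_sub_cancel_left, ENNReal.toReal_ofReal']
    exact max_le (le_abs_self h) (abs_nonneg h)
  -- Since `0⁻¹ = 0`, the bound covers every real `h`, so it holds along the whole index type of the
  -- limits below.
  rcases eq_or_ne h 0 with rfl | hh
  · simp
  · rw [Real.norm_eq_abs, inv_mul_le_iff₀ (abs_pos.2 hh), mul_one]
    exact this

/-- The convolution is the mean of `s ↦ shift s f` over `(t, t + h]`, a difference quotient of its
primitive. -/
theorem tendsto_conv_bump {t : ℝ} (ht : 0 ≤ t) (f : L1Plus) :
    Tendsto (fun h : ℝ => conv f (bump t h)) (𝓝[>] 0) (𝓝 (shift t f)) := by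
  have hc := continuous_shift f
  have hd := (intervalIntegral.integral_hasDerivAt_right (hc.intervalIntegrable t t)
    hc.stronglyMeasurable.stronglyMeasurableAtFilter hc.continuousAt).tendsto_slope_zero_right
  refine hd.congr' ?_
  filter_upwards [self_mem_nhdsWithin] with h hh
  have hh : 0 < h := hh
  rw [intervalIntegral.integral_same, sub_zero, intervalIntegral.integral_of_le (by linarith),
    conv_eq_integral]
  have e : ∀ᵐ s ∂volume.restrict (Ici (0 : ℝ)), bump t h s • shift s f =
      (Ioc t (t + h)).indicator (fun s => h⁻¹ • shift s f) s := by
    filter_upwards [indicatorConstLp_coeFn (p := 1) (hs := measurableSet_Ioc)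
      (hμs := ((Measure.restrict_apply_le _ _).trans_lt
        (measure_Ioc_lt_top (μ := volume) (a := t) (b := t + h))).ne) (c := (h⁻¹ : ℂ))] with s hs
    rw [bump, hs]
    by_cases hm : s ∈ Ioc t (t + h)
    · rw [indicator_of_mem hm, indicator_of_mem hm, ← Complex.ofReal_inv, Complex.coe_smul]
      rfl
    · rw [indicator_of_notMem hm, indicator_of_notMem hm, zero_smul]
  rw [integral_congr_ae e, integral_indicator measurableSet_Ioc,
    Measure.restrict_restrict measurableSet_Ioc, inter_eq_left.2, integral_smul]
  exact fun s hs => ht.trans hs.1.le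

end L1Plus

theorem IsConvHom.apply_conv_comm {A : Type*} [NonUnitalNormedRing A] [NormedSpace ℂ A]
    {T : L1Plus →L[ℂ] A} (hT : IsConvHom T) (f g : L1Plus) : T f * T g = T g * T f := by
  rw [← hT, ← hT, L1Plus.conv_comm]

theorem tendsto_mul_bump {A : Type*} [NonUnitalNormedRing A] [NormedSpace ℂ A]
    {T : L1Plus →L[ℂ] A} (hT : IsConvHom T) (f : L1Plus) {t : ℝ} (ht : 0 ≤ t) :
    Tendsto (fun h : ℝ => T f * T (L1Plus.bump t h)) (𝓝[>] 0) (𝓝 (T (L1Plus.shift t f))) := by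
  simp_rw [← hT f]
  exact (T.continuous.tendsto _).comp (L1Plus.tendsto_conv_bump ht f)

theorem norm_apply_bump_le {E : Type*} [NormedAddCommGroup E] [NormedSpace ℂ E]
    (T : L1Plus →L[ℂ] E) (t h : ℝ) : ‖T (L1Plus.bump t h)‖ ≤ ‖T‖ :=
  (T.le_opNorm _).trans (mul_le_of_le_one_right (norm_nonneg _) (L1Plus.norm_bump_le t h))

/-! ### Strong limits and the semigroup -/

section Semigroup

variable {X : Type*} [NormedAddCommGroup X] [NormedSpace ℂ X]

/-- The convergence set of a bounded family of operators is closed. -/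
theorem exists_tendsto_of_dense_span [CompleteSpace X] {ι : Type*} {l : Filter ι} [l.NeBot] {B : ι → X →L[ℂ] X}
    {C : ℝ} (hB : ∀ i, ‖B i‖ ≤ C) {s : Set X} (hs : Dense (Submodule.span ℂ s : Set X))
    (h : ∀ x ∈ s, ∃ y, Tendsto (fun i => B i x) l (𝓝 y)) (x : X) :
    ∃ y, Tendsto (fun i => B i x) l (𝓝 y) := by
  have hspan : ∀ x ∈ Submodule.span ℂ s, ∃ y, Tendsto (fun i => B i x) l (𝓝 y) := by
    intro x hx
    induction hx using Submodule.span_induction with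
    | mem x hx => exact h x hx
    | zero => exact ⟨0, by simp⟩
    | add x y _ _ hx hy =>
      obtain ⟨a, ha⟩ := hx
      obtain ⟨b, hb⟩ := hy
      exact ⟨a + b, by simpa using ha.add hb⟩
    | smul c x _ hx =>
      obtain ⟨a, ha⟩ := hx
      exact ⟨c • a, by simpa using ha.const_smul c⟩
  have hC : 0 ≤ C := by
    obtain ⟨i⟩ := l.nonempty_of_neBot
    exact (norm_nonneg _).trans (hB i)
  refine cauchy_map_iff_exists_tendsto.1 ?_
  refine Metric.cauchy_iff.2 ⟨inferInstance, fun ε hε => ?_⟩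
  obtain ⟨y, hy, hxy⟩ := Metric.mem_closure_iff.1 (hs x) (ε / (3 * (C + 1))) (by positivity)
  obtain ⟨a, ha⟩ := hspan y hy
  refine ⟨(fun i => B i x) '' {i | dist (B i y) a < ε / 6},
    image_mem_map (ha (Metric.ball_mem_nhds a (by positivity))), ?_⟩
  have hd : ∀ i, dist (B i x) (B i y) < ε / 3 := by
    intro i
    rw [dist_eq_norm, ← map_sub]
    calc ‖B i (x - y)‖ ≤ C * ‖x - y‖ := (B i).le_of_opNorm_le (hB i) _
      _ ≤ (C + 1) * ‖x - y‖ := by gcongr; linarith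
      _ < (C + 1) * (ε / (3 * (C + 1))) := by
        rw [← dist_eq_norm]
        gcongr
      _ = ε / 3 := by field_simp
  rintro _ ⟨i, hi, rfl⟩ _ ⟨k, hk, rfl⟩
  have h1 := hd i
  have h2 := hd k
  have hi : dist (B i y) a < ε / 6 := hi
  have hk : dist (B k y) a < ε / 6 := hk
  have h3 := dist_triangle4 (B i x) (B i y) (B k y) (B k x)
  have h4 := dist_triangle_right (B i y) (B k y) a
  rw [dist_comm (B k y)] at h3
  linarith

theorem continuous_orbit_of_dense_span {ι : Type*} [TopologicalSpace ι] {V : ι → X →L[ℂ] X}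
    {C : ℝ} (hV : ∀ t, ‖V t‖ ≤ C) {s : Set X} (hs : Dense (Submodule.span ℂ s : Set X))
    (h : ∀ x ∈ s, Continuous fun t => V t x) (x : X) : Continuous fun t => V t x := by
  have hspan : ∀ x ∈ Submodule.span ℂ s, Continuous fun t => V t x := by
    intro x hx
    induction hx using Submodule.span_induction with
    | mem x hx => exact h x hx
    | zero => simpa using continuous_const
    | add x y _ _ hx hy =>
      simp only [map_add]
      fun_prop
    | smul c x _ hx =>
      simp only [map_smul]
      fun_prop
  refine continuous_of_uniform_approx_of_continuous fun u hu => ?_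
  obtain ⟨ε, hε, hu⟩ := Metric.mem_uniformity_dist.1 hu
  have hC : 0 < |C| + 1 := by positivity
  obtain ⟨y, hy, hxy⟩ := Metric.mem_closure_iff.1 (hs x) (ε / (|C| + 1)) (by positivity)
  refine ⟨_, hspan y hy, fun t => hu ?_⟩
  rw [dist_eq_norm, ← map_sub]
  calc ‖V t (x - y)‖ ≤ C * ‖x - y‖ := (V t).le_of_opNorm_le (hV t) _
    _ ≤ (|C| + 1) * ‖x - y‖ := by gcongr; linarith [le_abs_self C]
    _ < (|C| + 1) * (ε / (|C| + 1)) := by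
      rw [← dist_eq_norm]
      gcongr
    _ = ε := by field_simp

/-- `V` is the strong limit of `S (bump t h)`. Commutativity of convolution moves the bump to the
left of `S f`. -/
theorem exists_shift_operator [CompleteSpace X] {S : L1Plus →L[ℂ] (X →L[ℂ] X)} (hS : IsConvHom S)
    (hd : Dense (Submodule.span ℂ {y | ∃ f x, S f x = y} : Set X)) {t : ℝ} (ht : 0 ≤ t) :
    ∃ V : X →L[ℂ] X, ‖V‖ ≤ ‖S‖ ∧ ∀ f x, V (S f x) = S (L1Plus.shift t f) x := by
  have hgen : ∀ f x, Tendsto (fun h : ℝ => S (L1Plus.bump t h) (S f x)) (𝓝[>] 0)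
      (𝓝 (S (L1Plus.shift t f) x)) := by
    intro f x
    have h := tendsto_mul_bump hS f ht
    simp_rw [hS.apply_conv_comm f] at h
    exact ((ContinuousLinearMap.apply ℂ X x).continuous.tendsto _).comp h
  have hB := norm_apply_bump_le S t
  choose W hW using exists_tendsto_of_dense_span (l := 𝓝[>] (0 : ℝ)) hB hd
    (by rintro _ ⟨f, x, rfl⟩; exact ⟨_, hgen f x⟩)
  refine ⟨continuousLinearMapOfTendsto _ (tendsto_pi_nhds.2 hW), ?_, fun f x => ?_⟩
  · refine ContinuousLinearMap.opNorm_le_bound _ (norm_nonneg S) fun x => ?_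
    exact le_of_tendsto (hW x).norm
      (Eventually.of_forall fun h => ContinuousLinearMap.le_of_opNorm_le _ (hB h) x)
  · exact tendsto_nhds_unique (hW _) (hgen f x)

/-- A convolution homomorphism into `𝓛(X)` whose ranges span a dense subspace is strongly
represented by a uniformly bounded `C₀`-semigroup. -/
theorem exists_semigroup_of_dense_span [CompleteSpace X] {S : L1Plus →L[ℂ] (X →L[ℂ] X)} (hS : IsConvHom S)
    (hd : Dense (Submodule.span ℂ {y | ∃ f x, S f x = y} : Set X)) :
    ∃ V : ℝ≥0 → X →L[ℂ] X, IsBoundedC0Semigroup V ∧ IsStronglyRepresentedBy S V := by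
  choose V hVn hV using fun t : ℝ≥0 => exists_shift_operator hS hd t.coe_nonneg
  have hcont : ∀ x, Continuous fun t => V t x := by
    refine continuous_orbit_of_dense_span hVn hd ?_
    rintro _ ⟨f, x, rfl⟩
    simp_rw [hV]
    exact (ContinuousLinearMap.apply ℂ X x).continuous.comp
      (S.continuous.comp ((L1Plus.continuous_shift f).comp NNReal.continuous_coe))
  refine ⟨V, ⟨?_, fun s t => ?_, hcont, ‖S‖, hVn⟩, fun g x => ?_⟩
  · refine ContinuousLinearMap.ext_on hd ?_
    rintro _ ⟨f, x, rfl⟩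
    rw [hV, NNReal.coe_zero, L1Plus.shift_zero]
    rfl
  · refine ContinuousLinearMap.ext_on hd ?_
    rintro _ ⟨f, x, rfl⟩
    rw [ContinuousLinearMap.comp_apply, hV, hV, hV, L1Plus.shift_shift _ t.coe_nonneg, NNReal.coe_add]
  · have hint : ∀ x, IntegrableOn (fun t : ℝ => g t • V t.toNNReal x) (Ici 0) := fun x =>
      (L1.integrable_coeFn g).smul_bdd (‖S‖ * ‖x‖)
        ((hcont x).comp continuous_real_toNNReal).aestronglyMeasurable
        (Eventually.of_forall fun t => (V _).le_of_opNorm_le (hVn _) x)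
    refine ⟨hint x, ?_⟩
    -- Once the integral is known to be a bounded operator, it need only be compared with `S g` on
    -- vectors `S f x`.
    let R : X →L[ℂ] X := LinearMap.mkContinuous
      { toFun := fun x => ∫ t in Ici (0 : ℝ), g t • V t.toNNReal x
        map_add' := fun x y => by
          simp only [map_add, smul_add]
          exact integral_add (hint x) (hint y)
        map_smul' := fun c x => by
          simp only [map_smul, smul_comm _ c, RingHom.id_apply]
          exact integral_smul c _ } (‖g‖ * ‖S‖) (fun x => by
        simp only [LinearMap.coe_mk, AddHom.coe_mk]
        rw [L1.norm_eq_integral_norm, mul_assoc, ← integral_mul_const]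
        refine norm_integral_le_of_norm_le ((L1.integrable_coeFn g).norm.mul_const _)
          (Eventually.of_forall fun t => ?_)
        rw [norm_smul]
        gcongr
        exact (V _).le_of_opNorm_le (hVn _) x)
    have hR : S g = R := by
      refine ContinuousLinearMap.ext_on hd ?_
      rintro _ ⟨f, x, rfl⟩
      change S g (S f x) = ∫ t in Ici (0 : ℝ), g t • V t.toNNReal (S f x)
      have h1 : S g (S f x) = ((ContinuousLinearMap.apply ℂ X x).comp S) (L1Plus.conv f g) := by
        rw [L1Plus.conv_comm, ContinuousLinearMap.comp_apply, hS]
        rfl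
      rw [h1, L1Plus.conv_eq_integral,
        ← ContinuousLinearMap.integral_comp_comm _ (L1Plus.integrable_smul_shift f g)]
      refine setIntegral_congr_fun measurableSet_Ici fun t ht => ?_
      rw [hV, Real.coe_toNNReal t ht, map_smul]
      rfl
    exact DFunLike.congr_fun hR x

/-! ### Restriction to the essential subspace -/

/-- The essential subspace of a family of operators. -/
def essentialSubspace (T : L1Plus →L[ℂ] (X →L[ℂ] X)) : Submodule ℂ X :=
  (Submodule.span ℂ {y | ∃ f x, T f x = y}).topologicalClosure

theorem isClosed_essentialSubspace (T : L1Plus →L[ℂ] (X →L[ℂ] X)) :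
    IsClosed (essentialSubspace T : Set X) :=
  Submodule.isClosed_topologicalClosure _

theorem apply_mem_essentialSubspace (T : L1Plus →L[ℂ] (X →L[ℂ] X)) (f : L1Plus) (x : X) :
    T f x ∈ essentialSubspace T :=
  Submodule.le_topologicalClosure _ (Submodule.subset_span ⟨f, x, rfl⟩)

/-- The restriction of a family of operators to its essential subspace. -/
noncomputable def essentialRestrict (T : L1Plus →L[ℂ] (X →L[ℂ] X)) :
    L1Plus →L[ℂ] (essentialSubspace T →L[ℂ] essentialSubspace T) :=
  LinearMap.mkContinuous
    { toFun := fun f => ((T f).comp (essentialSubspace T).subtypeL).codRestrict _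
        (fun x => apply_mem_essentialSubspace T f x)
      map_add' := fun f g => by
        ext x
        simp only [map_add]
        rfl
      map_smul' := fun c f => by
        ext x
        simp only [map_smul]
        rfl } ‖T‖ (fun f => by
      refine ContinuousLinearMap.opNorm_le_bound _ (by positivity) fun x => ?_
      exact (T f).le_of_opNorm_le (T.le_opNorm f) (x : X))

theorem norm_essentialRestrict_le (T : L1Plus →L[ℂ] (X →L[ℂ] X)) (f : L1Plus) :
    ‖essentialRestrict T f‖ ≤ ‖T f‖ :=
  ContinuousLinearMap.opNorm_le_bound _ (norm_nonneg _) fun x => (T f).le_opNorm (x : X)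

theorem isConvHom_essentialRestrict {T : L1Plus →L[ℂ] (X →L[ℂ] X)} (hT : IsConvHom T) :
    IsConvHom (A := essentialSubspace T →L[ℂ] essentialSubspace T) (essentialRestrict T) := by
  intro f g
  ext x
  change T _ (x : X) = T f (T g x)
  rw [hT]
  rfl

/-- `T g` is the norm limit of `T g * T (bump 0 h)`, and the right factor maps `X` into the
essential subspace with norm at most `‖T‖`. -/
theorem norm_apply_le_essentialRestrict {T : L1Plus →L[ℂ] (X →L[ℂ] X)} (hT : IsConvHom T)
    (g : L1Plus) : ‖T g‖ ≤ ‖T‖ * ‖essentialRestrict T g‖ := by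
  refine le_of_tendsto (by simpa [L1Plus.shift_zero] using (tendsto_mul_bump hT g le_rfl).norm)
    (Eventually.of_forall fun h => ?_)
  refine ContinuousLinearMap.opNorm_le_bound _ (by positivity) fun x => ?_
  have h1 := (essentialRestrict T g).le_opNorm
    ⟨T (L1Plus.bump 0 h) x, apply_mem_essentialSubspace T _ x⟩
  have h2 := (T (L1Plus.bump 0 h)).le_of_opNorm_le (norm_apply_bump_le T 0 h) x
  calc ‖T g (T (L1Plus.bump 0 h) x)‖
      ≤ ‖essentialRestrict T g‖ * ‖T (L1Plus.bump 0 h) x‖ := h1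
    _ ≤ ‖essentialRestrict T g‖ * (‖T‖ * ‖x‖) := by gcongr
    _ = ‖T‖ * ‖essentialRestrict T g‖ * ‖x‖ := by ring

/-- Restricting shrinks the ranges, but not their closed span: `T f x` is the limit of `T f (T (bump
0 h) x)`. -/
theorem dense_span_essentialRestrict {T : L1Plus →L[ℂ] (X →L[ℂ] X)} (hT : IsConvHom T) :
    Dense (Submodule.span ℂ {y | ∃ f x, essentialRestrict T f x = y} :
      Set (essentialSubspace T)) := by
  set K := (Submodule.span ℂ {y | ∃ f x, essentialRestrict T f x = y}).topologicalClosure with hK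
  have hgen : ∀ f x, (⟨T f x, apply_mem_essentialSubspace T f x⟩ : essentialSubspace T) ∈ K := by
    intro f x
    have h := tendsto_mul_bump hT f le_rfl
    rw [L1Plus.shift_zero] at h
    have h' := ((ContinuousLinearMap.apply ℂ X x).continuous.tendsto _).comp h
    refine (Submodule.isClosed_topologicalClosure _).mem_of_tendsto (b := 𝓝[>] (0 : ℝ))
      (f := fun h : ℝ => essentialRestrict T f
        ⟨T (L1Plus.bump 0 h) x, apply_mem_essentialSubspace T _ x⟩) ?_
      (Eventually.of_forall fun h =>
        Submodule.le_topologicalClosure _ (Submodule.subset_span ⟨_, _, rfl⟩))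
    exact tendsto_subtype_rng.2 h'
  have hcl : IsClosed ((K.map (essentialSubspace T).subtype) : Set X) := by
    rw [Submodule.map_coe]
    exact (isClosed_essentialSubspace T).isClosedEmbedding_subtypeVal.isClosedMap _
      (Submodule.isClosed_topologicalClosure _)
  have hle : essentialSubspace T ≤ K.map (essentialSubspace T).subtype := by
    refine Submodule.topologicalClosure_minimal _ (Submodule.span_le.2 ?_) hcl
    rintro _ ⟨f, x, rfl⟩
    exact ⟨_, hgen f x, rfl⟩
  intro y
  obtain ⟨z, hz, hzy⟩ := hle y.2
  rw [← Subtype.ext hzy]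
  exact hz

theorem hasEquivalentSemigroupHom_essentialSubspace [CompleteSpace X] {A : Type*} [NonUnitalNormedRing A]
    [NormedSpace ℂ A] {T : L1Plus →L[ℂ] A} {T' : L1Plus →L[ℂ] (X →L[ℂ] X)} (hT' : IsConvHom T')
    {a b : ℝ} (ha : ∀ g, ‖T g‖ ≤ a * ‖T' g‖) (hb : ∀ g, ‖T' g‖ ≤ b * ‖T g‖) :
    HasEquivalentSemigroupHom T (essentialSubspace T') := by
  have : CompleteSpace (essentialSubspace T') :=
    (isClosed_essentialSubspace T').completeSpace_coe
  obtain ⟨V, hV, hSV⟩ := exists_semigroup_of_dense_span (isConvHom_essentialRestrict hT')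
    (dense_span_essentialRestrict hT')
  -- Adding 1 keeps the constants positive even when `T' = 0`.
  have hc : 0 < |a| * ‖T'‖ + 1 := by positivity
  refine ⟨essentialRestrict T', V, isConvHom_essentialRestrict hT',
    ⟨|a| * ‖T'‖ + 1, (|a| * ‖T'‖ + 1) * (|b| + 1), hc, by positivity, fun g => ⟨?_, ?_⟩⟩, hV, hSV⟩
  · calc ‖T g‖ ≤ a * ‖T' g‖ := ha g
      _ ≤ |a| * (‖T'‖ * ‖essentialRestrict T' g‖) := by
        gcongr
        · exact le_abs_self a
        · exact norm_apply_le_essentialRestrict hT' g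
      _ ≤ (|a| * ‖T'‖ + 1) * ‖essentialRestrict T' g‖ := by
        nlinarith [norm_nonneg (essentialRestrict T' g)]
  · rw [mul_assoc]
    gcongr
    calc ‖essentialRestrict T' g‖ ≤ ‖T' g‖ := norm_essentialRestrict_le T' g
      _ ≤ b * ‖T g‖ := hb g
      _ ≤ (|b| + 1) * ‖T g‖ := by gcongr; linarith [le_abs_self b]

end Semigroup

/-- Left multiplication need not be faithful on a non-unital `A`, but on the range of `T` the
elements `T (bump 0 h)` act as a bounded approximate unit. -/
theorem norm_apply_le_mul_left {A : Type*} [NonUnitalNormedRing A] [NormedSpace ℂ A]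
    [IsScalarTower ℂ A A] [SMulCommClass ℂ A A] {T : L1Plus →L[ℂ] A} (hT : IsConvHom T)
    (g : L1Plus) : ‖T g‖ ≤ ‖T‖ * ‖ContinuousLinearMap.mul ℂ A (T g)‖ := by
  refine le_of_tendsto (by simpa [L1Plus.shift_zero] using (tendsto_mul_bump hT g le_rfl).norm)
    (Eventually.of_forall fun h => ?_)
  rw [mul_comm ‖T‖]
  exact (ContinuousLinearMap.mul ℂ A (T g)).le_opNorm_of_le (norm_apply_bump_le T 0 h)

theorem lemma3p1 {A : Type u} [NonUnitalNormedRing A] [NormedSpace ℂ A]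
    [IsScalarTower ℂ A A] [SMulCommClass ℂ A A] [CompleteSpace A]
    (T : L1Plus →L[ℂ] A) (hT : IsConvHom T) :
    (∃ (X₀ : Type u) (_ : NormedAddCommGroup X₀) (_ : NormedSpace ℂ X₀) (_ : CompleteSpace X₀),
      HasEquivalentSemigroupHom T X₀) ∧
    (∀ (X : Type v) [NormedAddCommGroup X] [NormedSpace ℂ X] [CompleteSpace X]
      (j : A →ₙₐ[ℂ] (X →L[ℂ] X)), Topology.IsClosedEmbedding j →
      ∃ X₀ : Submodule ℂ X, IsClosed (X₀ : Set X) ∧ HasEquivalentSemigroupHom T X₀) := by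
  constructor
  · have hL : IsConvHom ((ContinuousLinearMap.mul ℂ A).comp T) := by
      intro f g
      ext x
      simp [hT f g, mul_assoc]
    exact ⟨essentialSubspace ((ContinuousLinearMap.mul ℂ A).comp T), inferInstance, inferInstance,
      (isClosed_essentialSubspace _).completeSpace_coe,
      hasEquivalentSemigroupHom_essentialSubspace hL (norm_apply_le_mul_left hT)
        (b := 1) fun g => by
          simp⟩
  · intro X _ _ _ j hj
    let J : A →L[ℂ] (X →L[ℂ] X) := ⟨(j : A →ₗ[ℂ] (X →L[ℂ] X)), hj.continuous⟩
    -- A linear homeomorphism onto its image is bounded below, which gives the lower norm estimate.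
    obtain ⟨K, hK⟩ := J.antilipschitz_of_isEmbedding hj.isEmbedding
    have hJ : IsConvHom (J.comp T) := by
      intro f g
      change j (T (L1Plus.conv f g)) = j (T f) * j (T g)
      rw [hT, map_mul]
    exact ⟨essentialSubspace (J.comp T), isClosed_essentialSubspace _,
      hasEquivalentSemigroupHom_essentialSubspace hJ
        (fun g => J.bound_of_antilipschitz hK (T g)) (fun g => J.le_opNorm (T g))⟩
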